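/- Let $N,R\ge 1$ be integers and $0<p\le 1$. A machine is observed on $N$ consecutive days and starts in a working state. On each day on which it is in service it develops a fault with probability $p$, independently of everything before. A fault takes $R$ days to repair, so that after a fault on day $i$ the next day on which the machine is in service is day $i+R$ (if the day of the fault is counted as the first repair day) or day $i+R+1$ (if it is not); the result holds under either convention. Let $W$ be the number of faults during the $N$ days, $n=\lfloor N/R\rfloor+1$ and $\lambda=\mathbb E W>0$. Let $\mathrm{Po}^{[0,n]}(\lambda)$ be the law of a Poisson($\lambda$) random variable conditioned on being at most $n$. For $A\subseteq\{0,\dots,n\}$ and $f=1_A$ let $g_f$ be the solution of $$\lambda\, g_f(i+1)1_{\{i<n\}}-i\,g_f(i)=f(i)-\mathrm{Po}^{[0,n]}(\lambda)(A),\qquad 0\le i\le n,$$ with $g_f(0)=g_f(n+1)=0$, and let $$G_2^{[0,n]}=\sup_{A\subseteq\{0,\dots,n\}}\ \max_{0\le i\le n}|g_{1_A}(i+1)-g_{1_A}(i)|.$$ Then, with $d_{TV}(P,Q)=\sup_{A}|P(A)-Q(A)|$, $$d_{TV}(\mathcal L(W),\mathrm{Po}^{[0,n]}(\lambda))\le \lambda\,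 G_2^{[0,n]}\Bigl[1-\frac{\operatorname{Var}W}{\lambda}\Bigr],$$ and the right-hand side is $O(p)$: for fixed $N$ and $R$ there is a constant $C=C(N,R)$, not depending on $p$, such that it is at most $Cp$ in absolute value for all $0<p\le 1$. -/

import Mathlib

open MeasureTheory ProbabilityTheory

/-- The machine, observed on days `0, 1, 2, …`. On a day on which it is in service it develops a
fault iff the day's coin `x t` shows `true`; the coins of the days on which it is out of service
are ignored. After a fault day it is out of service for `down` further days.
`repairLeft down x t` is the number of days, counted from the start of day `t`, for which the
machine is still out of service; it is `0` iff the machine is in service on day `t`.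
The machine starts in service. -/
def repairLeft (down : ℕ) (x : ℕ → Bool) : ℕ → ℕ
  | 0 => 0
  | t + 1 =>
    if repairLeft down x t = 0 then (if x t = true then down else 0)
    else repairLeft down x t - 1

/-- The number of faults during the first `N` days. -/
def faultCount (down N : ℕ) (x : ℕ → Bool) : ℕ :=
  ((Finset.range N).filter fun t => repairLeft down x t = 0 ∧ x t = true).card

/-- Total variation distance of two distributions on `ℕ` (intended for probability measures, where
the supremum is over a bounded set). -/
noncomputable def dTV (P Q : Measure ℕ) : ℝ :=
  ⨆ A : Set ℕ, |P.real A - Q.real A|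

/-- The Poisson distribution with mean parameter `lam`, conditioned on being at most `n`. -/
noncomputable def truncPoisson (n : ℕ) (lam : ℝ) : Measure ℕ :=
  cond (poissonMeasure lam.toNNReal) (Set.Iic n)

/-- `g` solves the Stein equation of the truncated Poisson distribution
`lam * g (i + 1) * 1_{i < n} - i * g i = f i - E f(Z)`, `0 ≤ i ≤ n`, for `f = 1_A`.
The values `g 0` and `g (n + 1)`, which the equation leaves free, are zero by convention. -/
def IsSteinSolution (n : ℕ) (lam : ℝ) (A : Set ℕ) (g : ℕ → ℝ) : Prop :=
  g 0 = 0 ∧ g (n + 1) = 0 ∧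
    ∀ i ≤ n, lam * g (i + 1) * (if i < n then 1 else 0) - (i : ℝ) * g i
      = A.indicator (fun _ => (1 : ℝ)) i - (truncPoisson n lam).real A

/-- The Stein factor: the largest first difference, over `i ∈ {0, …, n}`, of the solutions of the
Stein equation for indicators of subsets of `{0, …, n}`. -/
noncomputable def steinFactor (n : ℕ) (lam : ℝ) : ℝ :=
  sSup {y : ℝ | ∃ A ⊆ Set.Iic n, ∃ g : ℕ → ℝ, IsSteinSolution n lam A g ∧
    ∃ i ≤ n, y = |g (i + 1) - g i|}

/-- The quantity `lam * G * (1 - v / lam)` for the truncation level `n`, mean `lam`,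
variance `v`. -/
noncomputable def steinBound (n : ℕ) (lam v : ℝ) : ℝ :=
  lam * steinFactor n lam * (1 - v / lam)

/-! This is Stein's method with size biasing. Write `W_N` for the fault count over `N` days. The key
inequality is E[W 1(W > k)] ≤ λ P(W ≥ k) for every k, i.e. the size-biased law of W is dominated by
that of W + 1 (`faultExpectation_sizeBias_le`). It follows by induction from the first coin, which
turns `W_{N+1}` into `W_N` or `W_{N-d} + 1`, together with the stochastic ordering `W_{N-d} ≤ W_N ≤
W_{N-d} + 1`.

Summation by parts writes E[λ g(W+1) - W g(W)] as Σ Δg(k) c_k, where c_k = λ P(W ≥ k) - E[W 1(W >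
k)] ≥ 0. Taking g(k) = k gives Σ c_k = λ - Var W, so the Stein error is at most sup|Δg| (λ - Var W)
(`dTV_truncPoisson_le_steinBound`).

For the rate O(p), the Stein factor is bounded uniformly for λ ≤ N, while λ ≤ Np and Var W ≤ nλ. -/

/-- The expectation of `φ` at the number of faults during `N` days, computed by conditioning on
the coin of the first day. -/
noncomputable def faultExpectation (d : ℕ) (p : ℝ) : ℕ → (ℕ → ℝ) → ℝ
  | 0, φ => φ 0
  | N + 1, φ => (1 - p) * faultExpectation d p N φ
      + p * faultExpectation d p (N - d) (fun k => φ (k + 1))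
termination_by N => N
decreasing_by all_goals omega

/-! ### Renewal recursion and stochastic ordering of the fault counts -/

section faultExpectation

variable {d : ℕ} {p : ℝ}

lemma faultExpectation_zero (φ : ℕ → ℝ) : faultExpectation d p 0 φ = φ 0 := by
  rw [faultExpectation]

lemma faultExpectation_succ (N : ℕ) (φ : ℕ → ℝ) :
    faultExpectation d p (N + 1) φ = (1 - p) * faultExpectation d p N φ
      + p * faultExpectation d p (N - d) (fun k => φ (k + 1)) := by
  rw [faultExpectation]

lemma faultExpectation_add (N : ℕ) (φ ψ : ℕ → ℝ) :
    faultExpectation d p N (fun k => φ k + ψ k)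
      = faultExpectation d p N φ + faultExpectation d p N ψ := by
  induction N using Nat.strong_induction_on generalizing φ ψ with
  | _ N ih =>
    cases N with
    | zero => simp only [faultExpectation_zero]
    | succ N =>
      simp only [faultExpectation_succ]
      rw [ih N (by omega), ih (N - d) (by omega)]
      ring

lemma faultExpectation_const (N : ℕ) (c : ℝ) : faultExpectation d p N (fun _ => c) = c := by
  induction N using Nat.strong_induction_on with
  | _ N ih =>
    cases N with
    | zero => simp only [faultExpectation_zero]
    | succ N =>
      simp only [faultExpectation_succ]
      rw [ih N (by omega), ih (N - d) (by omega)]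
      ring

lemma faultExpectation_mono (hp0 : 0 ≤ p) (hp1 : p ≤ 1) (N : ℕ) {φ ψ : ℕ → ℝ}
    (h : ∀ k, φ k ≤ ψ k) : faultExpectation d p N φ ≤ faultExpectation d p N ψ := by
  induction N using Nat.strong_induction_on generalizing φ ψ with
  | _ N ih =>
    cases N with
    | zero => simpa only [faultExpectation_zero] using h 0
    | succ N =>
      simp only [faultExpectation_succ]
      have h1 := ih N (by omega) h
      have h2 := ih (N - d) (by omega) (fun k => h (k + 1))
      have : 0 ≤ 1 - p := by linarith
      gcongr

/-- During `d` further days at most one further fault occurs. -/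
lemma faultExpectation_le_sub (hp0 : 0 ≤ p) (hp1 : p ≤ 1) (N : ℕ) {φ : ℕ → ℝ} (h : Monotone φ) :
    faultExpectation d p N φ ≤ faultExpectation d p (N - d) (fun k => φ (k + 1)) := by
  induction N using Nat.strong_induction_on generalizing φ with
  | _ N ih =>
    cases N with
    | zero => simpa only [Nat.zero_sub, faultExpectation_zero] using h (Nat.zero_le 1)
    | succ N =>
      have h2 := mul_le_mul_of_nonneg_left (ih N (by omega) h) (sub_nonneg.2 hp1)
      rw [faultExpectation_succ]
      -- If `d ≤ N`, the right side can also be expanded by its first coin; otherwise both truncated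
      -- horizons are 0.
      by_cases hd : d ≤ N
      · have h4 := mul_le_mul_of_nonneg_left (ih (N - d) (by omega)
          (φ := fun k => φ (k + 1)) fun a b hab => h (Nat.add_le_add_right hab 1)) hp0
        rw [show N + 1 - d = N - d + 1 by omega, faultExpectation_succ]
        linarith
      · rw [show N + 1 - d = N - d by omega]
        linarith

/-- A fault on the extra first day replaces `W_N` by `W_{N-d} + 1`, which dominates it. -/
lemma faultExpectation_le_succ (hp0 : 0 ≤ p) (hp1 : p ≤ 1) (N : ℕ) {φ : ℕ → ℝ} (h : Monotone φ) :
    faultExpectation d p N φ ≤ faultExpectation d p (N + 1) φ := by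
  rw [faultExpectation_succ]
  have := mul_le_mul_of_nonneg_left (faultExpectation_le_sub (d := d) hp0 hp1 N h) hp0
  linarith

lemma faultExpectation_sub_le (hp0 : 0 ≤ p) (hp1 : p ≤ 1) (N : ℕ) {φ : ℕ → ℝ} (h : Monotone φ) :
    faultExpectation d p (N - d) φ ≤ faultExpectation d p N φ :=
  monotone_nat_of_le_succ (fun n => faultExpectation_le_succ (d := d) hp0 hp1 n h) (N.sub_le d)

lemma faultExpectation_cast_succ (N : ℕ) :
    faultExpectation d p (N + 1) (fun k => (k : ℝ))
      = (1 - p) * faultExpectation d p N (fun k => (k : ℝ))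
        + p * (faultExpectation d p (N - d) (fun k => (k : ℝ)) + 1) := by
  rw [faultExpectation_succ]
  simp only [Nat.cast_add, Nat.cast_one]
  rw [faultExpectation_add, faultExpectation_const]

lemma faultExpectation_cast_nonneg (hp0 : 0 ≤ p) (hp1 : p ≤ 1) (N : ℕ) :
    0 ≤ faultExpectation d p N (fun k => (k : ℝ)) := by
  simpa only [faultExpectation_const] using
    faultExpectation_mono (d := d) (φ := fun _ => 0) hp0 hp1 N (fun k => k.cast_nonneg)

lemma le_faultExpectation_cast (hp0 : 0 ≤ p) (hp1 : p ≤ 1) {N : ℕ} (hN : 1 ≤ N) :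
    p ≤ faultExpectation d p N (fun k => (k : ℝ)) := by
  obtain ⟨N, rfl⟩ := Nat.exists_eq_add_of_le' hN
  rw [faultExpectation_cast_succ]
  have h1 := mul_nonneg (sub_nonneg.2 hp1) (faultExpectation_cast_nonneg (d := d) hp0 hp1 N)
  have h2 := mul_nonneg hp0 (faultExpectation_cast_nonneg (d := d) hp0 hp1 (N - d))
  linarith

lemma faultExpectation_cast_le (hp0 : 0 ≤ p) (hp1 : p ≤ 1) (N : ℕ) :
    faultExpectation d p N (fun k => (k : ℝ)) ≤ N * p := by
  induction N with
  | zero => simp [faultExpectation_zero]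
  | succ N ih =>
    rw [faultExpectation_cast_succ]
    have := mul_le_mul_of_nonneg_left
      (faultExpectation_sub_le (d := d) hp0 hp1 N Nat.mono_cast) hp0
    push_cast
    linarith

lemma monotone_ite_le (k : ℕ) : Monotone fun j : ℕ => if k ≤ j then (1 : ℝ) else 0 := by
  intro a b hab
  dsimp only
  split_ifs <;> first | omega | norm_num

/-- The size-biased number of faults is stochastically dominated by one plus the number of
faults. -/
lemma faultExpectation_sizeBias_le (hp0 : 0 ≤ p) (hp1 : p ≤ 1) (N k : ℕ) :
    faultExpectation d p N (fun j => (j : ℝ) * (if k < j then 1 else 0))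
      ≤ faultExpectation d p N (fun j => (j : ℝ))
        * faultExpectation d p N (fun j => if k ≤ j then 1 else 0) := by
  induction N using Nat.strong_induction_on generalizing k with
  | _ N ih =>
    cases k with
    | zero =>
      have : (fun j : ℕ => (j : ℝ) * (if 0 < j then 1 else 0)) = fun j : ℕ => (j : ℝ) := by
        funext j; rcases j.eq_zero_or_pos with rfl | hj <;> simp [*]
      simp only [this, Nat.zero_le, if_true, faultExpectation_const, mul_one, le_refl]
    | succ k =>
    cases N with
    | zero => simp [faultExpectation_zero]
    | succ N =>
      have hA : (fun j : ℕ => ((j + 1 : ℕ) : ℝ) * (if k + 1 < j + 1 then 1 else 0))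
          = fun j : ℕ => (j : ℝ) * (if k < j then 1 else 0) + (if k + 1 ≤ j then 1 else 0) := by
        funext j
        simp only [Nat.add_lt_add_iff_right, Nat.succ_le_iff]
        push_cast
        ring
      have h1 := ih N (by omega) (k + 1)
      have h2 := ih (N - d) (by omega) k
      -- In the notation set below, these give w ≤ u ≤ v and b ≤ a ≤ b + 1.
      have hwu := faultExpectation_sub_le (d := d) hp0 hp1 N (monotone_ite_le (k + 1))
      have huv := faultExpectation_le_sub (d := d) hp0 hp1 N (monotone_ite_le (k + 1))
      have hba := faultExpectation_sub_le (d := d) hp0 hp1 N Nat.mono_cast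
      have hab := faultExpectation_le_sub (d := d) hp0 hp1 N Nat.mono_cast
      simp only [Nat.cast_add, Nat.cast_one] at hab
      rw [faultExpectation_add, faultExpectation_const] at hab
      rw [faultExpectation_cast_succ, faultExpectation_succ, faultExpectation_succ, hA,
        faultExpectation_add]
      simp only [Nat.add_le_add_iff_right] at huv ⊢
      set a := faultExpectation d p N (fun j => (j : ℝ))
      set b := faultExpectation d p (N - d) (fun j => (j : ℝ))
      set u := faultExpectation d p N (fun j => if k + 1 ≤ j then (1 : ℝ) else 0)
      set v := faultExpectation d p (N - d) (fun j => if k ≤ j then (1 : ℝ) else 0)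
      set w := faultExpectation d p (N - d) (fun j => if k + 1 ≤ j then (1 : ℝ) else 0)
      -- After the induction hypotheses, the right side exceeds the left by at least p[(v - w) - (1
      -- - p)(1 + b - a)(v - u)], which `h5` shows to be nonnegative.
      have h3 := mul_le_mul_of_nonneg_left h1 (sub_nonneg.2 hp1)
      have h4 := mul_le_mul_of_nonneg_left h2 hp0
      have h5 : (1 - p) * ((1 + b - a) * (v - u)) ≤ v - w := by
        have h6 : (1 + b - a) * (v - u) ≤ v - u := mul_le_of_le_one_left (by linarith) (by linarith)
        have h7 : 0 ≤ (1 + b - a) * (v - u) := mul_nonneg (by linarith) (by linarith)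
        have h8 := mul_nonneg hp0 h7
        linarith
      have h9 := mul_le_mul_of_nonneg_left h5 hp0
      linarith

end faultExpectation

/-! ### Stein equation of the truncated Poisson law -/

section Stein

variable {n : ℕ} {lam : ℝ}

lemma isProbabilityMeasure_truncPoisson (hlam : 0 < lam) :
    IsProbabilityMeasure (truncPoisson n lam) := by
  refine cond_isProbabilityMeasure fun h => ?_
  have h0 := poissonMeasure_real_singleton_pos 0 (Real.toNNReal_pos.2 hlam)
  rw [measureReal_def, measure_mono_null
    (Set.singleton_subset_iff.2 (Set.mem_Iic.2 (Nat.zero_le n))) h] at h0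
  simp at h0

lemma truncPoisson_compl_Iic : truncPoisson n lam (Set.Iic n)ᶜ = 0 := by
  rw [truncPoisson, cond_apply measurableSet_Iic, Set.inter_compl_self, measure_empty, mul_zero]

lemma exists_truncPoisson_real_singleton (hlam : 0 < lam) :
    ∃ c : ℝ, ∀ j ≤ n, (truncPoisson n lam).real {j} = c * (lam ^ j / (j.factorial : ℝ)) := by
  refine ⟨((poissonMeasure lam.toNNReal).real (Set.Iic n))⁻¹ * Real.exp (-lam), fun j hj => ?_⟩
  rw [truncPoisson, measureReal_def, cond_apply measurableSet_Iic, ENNReal.toReal_mul,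
    ENNReal.toReal_inv, ← measureReal_def, ← measureReal_def,
    Set.inter_eq_self_of_subset_right (Set.singleton_subset_iff.2 (Set.mem_Iic.2 hj)),
    poissonMeasure_real_singleton, Real.coe_toNNReal _ hlam.le]
  ring

lemma measureReal_eq_sum_range {ν : Measure ℕ} [IsFiniteMeasure ν] (hν : ν (Set.Iic n)ᶜ = 0)
    (A : Set ℕ) :
    ν.real A = ∑ j ∈ Finset.range (n + 1), ν.real {j} * A.indicator (fun _ => (1 : ℝ)) j := by
  classical
  have hA : ν.real A = ν.real ((Finset.range (n + 1)).filter (· ∈ A) : Finset ℕ) := by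
    refine measureReal_congr ?_
    refine Filter.EventuallyEq.symm (Filter.mem_of_superset (compl_mem_ae_iff.2 hν) fun j hj => ?_)
    have hj' : j < n + 1 := by simpa [Nat.lt_succ_iff] using hj
    refine propext ?_
    change j ∈ ((Finset.range (n + 1)).filter (· ∈ A) : Finset ℕ) ↔ j ∈ A
    simp [hj']
  rw [hA, ← sum_measureReal_singleton, Finset.sum_filter]
  refine Finset.sum_congr rfl fun j _ => ?_
  by_cases h : j ∈ A <;> simp [h]

lemma sum_weight_mul_centred_indicator (hlam : 0 < lam) (A : Set ℕ) :
    ∑ j ∈ Finset.range (n + 1), lam ^ j / (j.factorial : ℝ)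
      * (A.indicator (fun _ => (1 : ℝ)) j - (truncPoisson n lam).real A) = 0 := by
  have := isProbabilityMeasure_truncPoisson (n := n) hlam
  obtain ⟨c, hc⟩ := exists_truncPoisson_real_singleton (n := n) hlam
  have key : ∀ B : Set ℕ, (truncPoisson n lam).real B
      = c * ∑ j ∈ Finset.range (n + 1), lam ^ j / (j.factorial : ℝ)
        * B.indicator (fun _ => (1 : ℝ)) j := by
    intro B
    rw [measureReal_eq_sum_range truncPoisson_compl_Iic, Finset.mul_sum]
    refine Finset.sum_congr rfl fun j hj => ?_
    rw [hc j (Nat.lt_succ_iff.1 (Finset.mem_range.1 hj))]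
    ring
  have h1 := key Set.univ
  rw [probReal_univ] at h1
  simp only [Set.indicator_univ, mul_one] at h1
  have hc0 : c ≠ 0 := by rintro rfl; simp at h1
  refine (mul_eq_zero.1 ?_).resolve_left hc0
  simp only [mul_sub, Finset.sum_sub_distrib, ← Finset.sum_mul]
  rw [← key A, ← mul_assoc, ← h1, one_mul, sub_self]

/-- Multiplied by λ^i / i!, the equation telescopes, so g is a normalised partial sum of the centred
indicator. The full sum vanishes, which gives g(n + 1) = 0. -/
lemma exists_isSteinSolution (hlam : 0 < lam) (A : Set ℕ) :
    ∃ g : ℕ → ℝ, IsSteinSolution n lam A g := by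
  set h : ℕ → ℝ := fun j => A.indicator (fun _ => (1 : ℝ)) j - (truncPoisson n lam).real A with hh
  set S : ℕ → ℝ := fun i => ∑ j ∈ Finset.range i, lam ^ j / (j.factorial : ℝ) * h j with hS
  have hn : S (n + 1) = 0 := sum_weight_mul_centred_indicator hlam A
  -- At `i = 0` the truncated `i - 1` is harmless, since `S 0 = 0`.
  refine ⟨fun i => ((i - 1).factorial : ℝ) / lam ^ i * S i, by simp [hS], by simp [hn], ?_⟩
  intro i hi
  have h1 : lam * ((i.factorial : ℝ) / lam ^ (i + 1) * S (i + 1)) * (if i < n then 1 else 0)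
      = lam * ((i.factorial : ℝ) / lam ^ (i + 1) * S (i + 1)) := by
    rcases hi.lt_or_eq with hi | rfl
    · simp [hi]
    · simp [hn]
  have h2 : (i : ℝ) * (((i - 1).factorial : ℝ) / lam ^ i * S i)
      = (i.factorial : ℝ) / lam ^ i * S i := by
    cases i with
    | zero => simp [hS]
    | succ i => rw [Nat.factorial_succ]; push_cast; ring
  have h3 : S (i + 1) = S i + lam ^ i / (i.factorial : ℝ) * h i := Finset.sum_range_succ _ _
  simp only [Nat.add_sub_cancel]
  rw [h1, h2, h3]
  change _ = h i
  have := Nat.factorial_ne_zero i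
  field_simp
  ring

lemma abs_centred_indicator_le_one (hlam : 0 < lam) (A : Set ℕ) (i : ℕ) :
    |A.indicator (fun _ => (1 : ℝ)) i - (truncPoisson n lam).real A| ≤ 1 := by
  have := isProbabilityMeasure_truncPoisson (n := n) hlam
  have h0 : 0 ≤ (truncPoisson n lam).real A := measureReal_nonneg
  have h1 : (truncPoisson n lam).real A ≤ 1 := measureReal_le_one
  rw [abs_le]
  by_cases h : i ∈ A <;> simp only [h, Set.indicator_of_mem, Set.indicator_of_notMem,
    not_false_eq_true] <;> constructor <;> linarith

lemma IsSteinSolution.apply_eq {A : Set ℕ} {g : ℕ → ℝ} (hg : IsSteinSolution n lam A g) {i : ℕ}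
    (hi : i ≤ n) : lam * g (i + 1) - i * g i
      = A.indicator (fun _ => (1 : ℝ)) i - (truncPoisson n lam).real A := by
  rw [← hg.2.2 i hi]
  rcases hi.lt_or_eq with h | rfl
  · simp [h]
  · simp [hg.2.1]

/-- Backward recursion from g(n + 1) = 0 divides by j ≥ 1 and never by λ, so the bound does not blow
up as λ → 0. -/
lemma IsSteinSolution.abs_le {A : Set ℕ} {g : ℕ → ℝ} (hg : IsSteinSolution n lam A g)
    (hlam : 0 < lam) {B : ℝ} (hB : lam ≤ B) {i : ℕ} (hi : i ≤ n + 1) :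
    |g i| ≤ (B + 1) ^ (n + 1) := by
  have hB1 : 1 ≤ B + 1 := by linarith
  have key : ∀ m ≤ n + 1, |g (n + 1 - m)| ≤ (B + 1) ^ m := by
    intro m
    induction m with
    | zero => intro _; simp [hg.2.1]
    | succ m ih =>
      intro hm
      rcases Nat.eq_zero_or_pos (n - m) with h | h
      · rw [show n + 1 - (m + 1) = 0 by omega, hg.1, abs_zero]
        positivity
      obtain ⟨j, hj⟩ : ∃ j, j = n + 1 - (m + 1) := ⟨_, rfl⟩
      have h1 := ih (by omega)
      rw [← hj]
      rw [show n + 1 - m = j + 1 by omega] at h1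
      have hjr : (1 : ℝ) ≤ j := by exact_mod_cast (show 1 ≤ j by omega)
      have h2 := hg.apply_eq (show j ≤ n by omega)
      have h3 := abs_centred_indicator_le_one (n := n) hlam A j
      rw [← h2] at h3
      calc |g j| ≤ j * |g j| := le_mul_of_one_le_left (abs_nonneg _) hjr
        _ = |j * g j| := by rw [abs_mul, Nat.abs_cast]
        _ = |lam * g (j + 1) - (lam * g (j + 1) - j * g j)| := by congr 1; ring
        _ ≤ |lam * g (j + 1)| + |lam * g (j + 1) - j * g j| := abs_sub _ _
        _ ≤ B * (B + 1) ^ m + (B + 1) ^ m := by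
          rw [abs_mul, abs_of_pos hlam]
          have := one_le_pow₀ hB1 (n := m)
          gcongr
          · linarith
          · exact h3.trans this
        _ = (B + 1) ^ (m + 1) := by ring
  have := key (n + 1 - i) (by omega)
  rw [Nat.sub_sub_self hi] at this
  exact this.trans (pow_le_pow_right₀ hB1 (by omega))

lemma steinDifference_le (hlam : 0 < lam) {B : ℝ} (hB : lam ≤ B) {y : ℝ}
    (hy : ∃ A ⊆ Set.Iic n, ∃ g : ℕ → ℝ, IsSteinSolution n lam A g ∧
      ∃ i ≤ n, y = |g (i + 1) - g i|) : y ≤ 2 * (B + 1) ^ (n + 1) := by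
  obtain ⟨A, -, g, hg, i, hi, rfl⟩ := hy
  have h1 := hg.abs_le hlam hB (show i + 1 ≤ n + 1 by omega)
  have h2 := hg.abs_le hlam hB (show i ≤ n + 1 by omega)
  linarith [abs_sub (g (i + 1)) (g i)]

lemma steinFactor_nonneg : 0 ≤ steinFactor n lam := by
  refine Real.sSup_nonneg ?_
  rintro y ⟨A, -, g, -, i, -, rfl⟩
  exact abs_nonneg _

lemma steinFactor_le (hlam : 0 < lam) {B : ℝ} (hB : lam ≤ B) :
    steinFactor n lam ≤ 2 * (B + 1) ^ (n + 1) :=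
  Real.sSup_le (fun _ hy => steinDifference_le hlam hB hy)
    (by have : 0 < B := hlam.trans_le hB; positivity)

/-- The crude bound on differences is needed here: the real `sSup` dominates its set only when the
set is bounded above. -/
lemma IsSteinSolution.abs_sub_le_steinFactor {A : Set ℕ} {g : ℕ → ℝ}
    (hg : IsSteinSolution n lam A g) (hA : A ⊆ Set.Iic n) (hlam : 0 < lam) {i : ℕ} (hi : i ≤ n) :
    |g (i + 1) - g i| ≤ steinFactor n lam :=
  le_csSup ⟨_, fun _ hy => steinDifference_le hlam le_rfl hy⟩ ⟨A, hA, g, hg, i, hi, rfl⟩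

lemma steinBound_eq (hlam : lam ≠ 0) (v : ℝ) : steinBound n lam v = steinFactor n lam * (lam - v) := by
  rw [steinBound]
  field_simp

lemma sum_range_mul_ite_lt (a : ℕ → ℝ) {j : ℕ} (hj : j ≤ n) :
    ∑ k ∈ Finset.range (n + 1), a k * (if k < j then 1 else 0) = ∑ k ∈ Finset.range j, a k := by
  simp only [mul_ite, mul_one, mul_zero]
  rw [← Finset.sum_filter]
  congr 1
  ext k
  simp only [Finset.mem_filter, Finset.mem_range]
  omega

lemma sum_range_mul_ite_le (a : ℕ → ℝ) {j : ℕ} (hj : j ≤ n) :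
    ∑ k ∈ Finset.range (n + 1), a k * (if k ≤ j then 1 else 0)
      = ∑ k ∈ Finset.range (j + 1), a k := by
  simp only [mul_ite, mul_one, mul_zero]
  rw [← Finset.sum_filter]
  congr 1
  ext k
  simp only [Finset.mem_filter, Finset.mem_range]
  omega

end Stein

/-! ### From size-bias domination to total variation -/

section SizeBias

variable {Ω : Type*} [MeasurableSpace Ω] {μ : Measure Ω} [IsProbabilityMeasure μ] {W : Ω → ℕ}
  {n : ℕ} {lam : ℝ}

lemma integrable_comp_of_le (hW : Measurable W) (hn : ∀ ω, W ω ≤ n) (φ : ℕ → ℝ) :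
    Integrable (fun ω => φ (W ω)) μ := by
  refine Integrable.of_bound ((Measurable.of_discrete (f := φ)).comp hW).aestronglyMeasurable
    (∑ k ∈ Finset.range (n + 1), |φ k|) (Filter.Eventually.of_forall fun ω => ?_)
  exact Finset.single_le_sum (f := fun k => |φ k|) (fun _ _ => abs_nonneg _)
    (Finset.mem_range.2 (Nat.lt_succ_iff.2 (hn ω)))

/-- `∫ (lam * g (W + 1) - W * g W)` as a combination of the first differences of `g`. -/
lemma integral_stein_eq_sum (hW : Measurable W) (hn : ∀ ω, W ω ≤ n) {g : ℕ → ℝ} (h0 : g 0 = 0) :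
    ∫ ω, (lam * g (W ω + 1) - W ω * g (W ω)) ∂μ
      = ∑ k ∈ Finset.range (n + 1), (g (k + 1) - g k)
        * (lam * ∫ ω, (if k ≤ W ω then 1 else 0) ∂μ
            - ∫ ω, (W ω : ℝ) * (if k < W ω then 1 else 0) ∂μ) := by
  have hi : ∀ φ : ℕ → ℝ, Integrable (fun ω => φ (W ω)) μ := integrable_comp_of_le hW hn
  have h1 : ∀ ω, lam * g (W ω + 1) - W ω * g (W ω) = ∑ k ∈ Finset.range (n + 1),
      (g (k + 1) - g k) * (lam * (if k ≤ W ω then 1 else 0)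
        - (W ω : ℝ) * (if k < W ω then 1 else 0)) := by
    intro ω
    -- As g(0) = 0, both g(W + 1) and g(W) are telescoping sums of differences.
    have h2 := sum_range_mul_ite_le (fun k => g (k + 1) - g k) (hn ω)
    have h3 := sum_range_mul_ite_lt (fun k => g (k + 1) - g k) (hn ω)
    rw [Finset.sum_range_sub, h0, sub_zero] at h2 h3
    rw [← h2, ← h3, Finset.mul_sum, Finset.mul_sum, ← Finset.sum_sub_distrib]
    exact Finset.sum_congr rfl fun k _ => by ring
  simp only [h1]
  rw [integral_finsetSum]
  · refine Finset.sum_congr rfl fun k _ => ?_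
    rw [integral_const_mul, integral_sub, integral_const_mul]
    · exact hi fun j => lam * (if k ≤ j then 1 else 0)
    · exact hi fun j => (j : ℝ) * (if k < j then 1 else 0)
  · exact fun k _ => hi fun j => (g (k + 1) - g k) * (lam * (if k ≤ j then 1 else 0)
        - (j : ℝ) * (if k < j then 1 else 0))

/-- If the size-biased distribution of `W` is stochastically dominated by the distribution of
`W + 1`, then the truncated Poisson approximation holds with the Stein bound. -/
theorem dTV_truncPoisson_le_steinBound (hW : Measurable W) (hn : ∀ ω, W ω ≤ n)
    (hlam : lam = ∫ ω, (W ω : ℝ) ∂μ) (hpos : 0 < lam)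
    (hdom : ∀ k, ∫ ω, (W ω : ℝ) * (if k < W ω then 1 else 0) ∂μ
      ≤ lam * ∫ ω, (if k ≤ W ω then 1 else 0) ∂μ) :
    dTV (μ.map W) (truncPoisson n lam)
      ≤ steinBound n lam (variance (fun ω => (W ω : ℝ)) μ) := by
  have hi : ∀ φ : ℕ → ℝ, Integrable (fun ω => φ (W ω)) μ := integrable_comp_of_le hW hn
  have := isProbabilityMeasure_truncPoisson (n := n) hpos
  have := Measure.isProbabilityMeasure_map (μ := μ) hW.aemeasurable
  have hWn : μ.map W (Set.Iic n)ᶜ = 0 := by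
    rw [Measure.map_apply hW (.of_discrete)]
    convert measure_empty (μ := μ)
    ext ω
    simpa using hn ω
  refine ciSup_le fun A => ?_
  -- The Stein factor only covers subsets of {0, …, n}, which carries both laws.
  have hinter : ∀ (ν : Measure ℕ), ν (Set.Iic n)ᶜ = 0 → ν.real A = ν.real (A ∩ Set.Iic n) :=
    fun ν hν => (measureReal_congr (inter_ae_eq_left_of_ae_eq_univ (ae_eq_univ.2 hν))).symm
  rw [hinter _ hWn, hinter _ truncPoisson_compl_Iic]
  set A' := A ∩ Set.Iic n
  obtain ⟨g, hg⟩ := exists_isSteinSolution (n := n) hpos A'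
  have hE : (μ.map W).real A' - (truncPoisson n lam).real A'
      = ∫ ω, (lam * g (W ω + 1) - W ω * g (W ω)) ∂μ := by
    simp only [fun ω => hg.apply_eq (hn ω)]
    rw [integral_sub (hi _) (integrable_const _), integral_const, probReal_univ, one_smul,
      map_measureReal_apply hW .of_discrete]
    congr 1
    rw [← integral_indicator_one (hW .of_discrete)]
    rfl
  -- λ - Var W is the Stein expression at the identity, whose differences are all 1.
  have hvar : lam - variance (fun ω => (W ω : ℝ)) μ
      = ∫ ω, (lam * ((W ω + 1 : ℕ) : ℝ) - W ω * (W ω : ℝ)) ∂μ := by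
    rw [variance_eq_sub, integral_sub (hi fun j => lam * ((j + 1 : ℕ) : ℝ))
      (hi fun j => (j : ℝ) * j), integral_const_mul]
    · push_cast
      rw [integral_add (hi fun j => (j : ℝ)) (integrable_const _), ← hlam]
      simp only [integral_const, probReal_univ, one_smul, Pi.pow_apply, sq]
      ring
    · exact (memLp_two_iff_integrable_sq (hi fun j => (j : ℝ)).aestronglyMeasurable).2
        (hi fun j => (j : ℝ) ^ 2)
  rw [hE, steinBound_eq hpos.ne', hvar, integral_stein_eq_sum hW hn hg.1,
    integral_stein_eq_sum (g := fun k => (k : ℝ)) hW hn Nat.cast_zero, Finset.mul_sum]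
  refine (Finset.abs_sum_le_sum_abs _ _).trans (Finset.sum_le_sum fun k hk => ?_)
  rw [abs_mul, abs_of_nonneg (sub_nonneg.2 (hdom k)), Nat.cast_succ, add_sub_cancel_left, one_mul]
  exact mul_le_mul_of_nonneg_right (hg.abs_sub_le_steinFactor Set.inter_subset_right hpos
    (Nat.lt_succ_iff.1 (Finset.mem_range.1 hk))) (sub_nonneg.2 (hdom k))

lemma variance_le_mul_integral (hW : Measurable W) (hn : ∀ ω, W ω ≤ n) :
    variance (fun ω => (W ω : ℝ)) μ ≤ n * ∫ ω, (W ω : ℝ) ∂μ := by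
  have hi : ∀ φ : ℕ → ℝ, Integrable (fun ω => φ (W ω)) μ := integrable_comp_of_le hW hn
  refine (variance_le_expectation_sq (hi fun j => (j : ℝ)).aestronglyMeasurable).trans ?_
  rw [← integral_const_mul]
  refine integral_mono (hi fun j => (j : ℝ) ^ 2) (hi fun j => (n : ℝ) * j) fun ω => ?_
  have : (W ω : ℝ) ≤ n := by exact_mod_cast hn ω
  simp only [Pi.pow_apply, sq]
  gcongr

end SizeBias

/-! ### Pathwise restart of the machine after the first day -/

section FaultCount

variable {d : ℕ}

lemma faultCount_eq_sum (N : ℕ) (x : ℕ → Bool) :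
    faultCount d N x
      = ∑ t ∈ Finset.range N, if repairLeft d x t = 0 ∧ x t = true then 1 else 0 :=
  Finset.card_filter _ _

lemma repairLeft_succ_of_false {x : ℕ → Bool} (h : x 0 = false) (t : ℕ) :
    repairLeft d x (t + 1) = repairLeft d (fun s => x (s + 1)) t := by
  induction t with
  | zero => simp [repairLeft, h]
  | succ t ih => rw [repairLeft, ih, repairLeft]

lemma repairLeft_succ_of_true {x : ℕ → Bool} (h : x 0 = true) {t : ℕ} (ht : t ≤ d) :
    repairLeft d x (t + 1) = d - t := by
  induction t with
  | zero => simp [repairLeft, h]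
  | succ t ih =>
    have := ih (by omega)
    rw [repairLeft, this, if_neg (by omega)]
    omega

lemma repairLeft_add_of_true {x : ℕ → Bool} (h : x 0 = true) (t : ℕ) :
    repairLeft d x (d + 1 + t) = repairLeft d (fun s => x (d + 1 + s)) t := by
  induction t with
  | zero => rw [Nat.add_zero, repairLeft_succ_of_true h le_rfl, Nat.sub_self, repairLeft]
  | succ t ih => rw [← Nat.add_assoc, repairLeft, ih, repairLeft]

lemma faultCount_succ_of_false {x : ℕ → Bool} (h : x 0 = false) (N : ℕ) :
    faultCount d (N + 1) x = faultCount d N (fun s => x (s + 1)) := by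
  rw [faultCount_eq_sum, faultCount_eq_sum, Finset.sum_range_succ']
  simp [h, repairLeft_succ_of_false h]

lemma faultCount_succ_of_true {x : ℕ → Bool} (h : x 0 = true) (N : ℕ) :
    faultCount d (N + 1) x = faultCount d (N - d) (fun s => x (d + 1 + s)) + 1 := by
  have hd : ∀ m ≤ d, ∑ t ∈ Finset.range (m + 1),
      (if repairLeft d x t = 0 ∧ x t = true then 1 else 0) = 1 := by
    intro m hm
    rw [Finset.sum_range_succ', Finset.sum_eq_zero]
    · simp [repairLeft, h]
    · intro t ht
      have := Finset.mem_range.1 ht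
      rw [repairLeft_succ_of_true h (by omega), if_neg (by omega)]
  rw [faultCount_eq_sum, faultCount_eq_sum]
  rcases le_total N d with hN | hN
  · rw [hd N hN, Nat.sub_eq_zero_of_le hN, Finset.sum_range_zero]
  · rw [show N + 1 = d + 1 + (N - d) by omega, Finset.sum_range_add, hd d le_rfl, Nat.add_comm]
    simp only [repairLeft_add_of_true h]

/-- Successive faults are at least d + 1 ≥ R days apart; the last one may be cut off by the horizon,
hence the extra 1. The hypothesis `R ≤ d + 1` covers both repair conventions. -/
lemma faultCount_le {R : ℕ} (hR : 1 ≤ R) (hd : R ≤ d + 1) (N : ℕ) (x : ℕ → Bool) :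
    faultCount d N x ≤ N / R + 1 := by
  induction N using Nat.strong_induction_on generalizing x with
  | _ N ih =>
    cases N with
    | zero => simp [faultCount]
    | succ N =>
      cases h : x 0 with
      | false =>
        rw [faultCount_succ_of_false h]
        exact (ih N (by omega) _).trans
          (Nat.add_le_add_right (Nat.div_le_div_right (Nat.le_succ N)) 1)
      | true =>
        rw [faultCount_succ_of_true h]
        refine Nat.add_le_add_right ?_ 1
        by_cases hN : R ≤ N + 1
        · have h1 := ih (N - d) (by omega) (fun s => x (d + 1 + s))
          have h2 : (N - d) / R ≤ (N + 1 - R) / R := Nat.div_le_div_right (by omega)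
          have h3 := Nat.div_eq_sub_div (show 0 < R by omega) hN
          omega
        · rw [show N - d = 0 by omega]
          simp [faultCount]

lemma measurableSet_fun_eq {α β : Type*} [MeasurableSpace α] [MeasurableSpace β]
    [MeasurableSingletonClass β] {f : α → β} (hf : Measurable f) (b : β) :
    MeasurableSet {a | f a = b} :=
  hf (measurableSet_singleton b)

lemma measurable_repairLeft (t : ℕ) : Measurable fun x : ℕ → Bool => repairLeft d x t := by
  induction t with
  | zero => exact measurable_const
  | succ t ih =>
    simp only [repairLeft]
    refine Measurable.ite (measurableSet_fun_eq ih 0)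
      (Measurable.ite
        (measurableSet_fun_eq (f := fun x : ℕ → Bool => x t) (measurable_pi_apply t) true)
        measurable_const measurable_const) ?_
    exact (Measurable.of_discrete (f := fun m : ℕ => m - 1)).comp ih

lemma measurable_faultCount (N : ℕ) : Measurable (faultCount d N) := by
  have : faultCount d N = fun x => ∑ t ∈ Finset.range N,
      if repairLeft d x t = 0 ∧ x t = true then 1 else 0 := funext (faultCount_eq_sum N)
  rw [this]
  refine Finset.measurable_sum _ fun t _ => Measurable.ite ?_ measurable_const measurable_const
  exact (measurableSet_fun_eq (measurable_repairLeft t) 0).inter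
    (measurableSet_fun_eq (f := fun x : ℕ → Bool => x t) (measurable_pi_apply t) true)

lemma faultCount_le_days (N : ℕ) (x : ℕ → Bool) : faultCount d N x ≤ N :=
  (Finset.card_filter_le _ _).trans_eq (Finset.card_range N)

end FaultCount

/-! ### Independent coins realise the recursion -/

section Coins

variable {Ω : Type*} [MeasurableSpace Ω] {μ : Measure Ω} [IsProbabilityMeasure μ]
  {x : ℕ → Ω → Bool} {d : ℕ} {p : ℝ}

lemma indepFun_zero_succ (hm : ∀ t, Measurable (x t)) (hx : iIndepFun x μ) :
    IndepFun (x 0) (fun ω t => x (t + 1) ω) μ := by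
  refine IndepFun.indepFun_process (hm 0) (fun t => hm (t + 1)) fun I => ?_
  have h := hx.indepFun_finset {0} (I.map (addRightEmbedding 1)) (by simp) hm
  exact h.comp (φ := fun f : ({0} : Finset ℕ) → Bool => f ⟨0, Finset.mem_singleton_self 0⟩)
    (ψ := fun f : (I.map (addRightEmbedding 1) : Finset ℕ) → Bool =>
      fun i : I => f ⟨i + 1, Finset.mem_map_of_mem _ i.2⟩)
    (measurable_pi_apply _) (measurable_pi_lambda _ fun _ => measurable_pi_apply _)

/-- A functional of the coins after the first day is independent of the first coin. -/
lemma integral_ite_zero_mul (hm : ∀ t, Measurable (x t)) (hx : iIndepFun x μ) (b : Bool)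
    {ψ : (ℕ → Bool) → ℝ} (hψ : Measurable ψ) :
    ∫ ω, (if x 0 ω = b then 1 else 0) * ψ (fun t => x (t + 1) ω) ∂μ
      = μ.real {ω | x 0 ω = b} * ∫ ω, ψ (fun t => x (t + 1) ω) ∂μ := by
  have h := (indepFun_zero_succ hm hx).comp
    (φ := fun c : Bool => if c = b then (1 : ℝ) else 0) .of_discrete hψ
  have h2 := h.integral_fun_mul_eq_mul_integral
    ((Measurable.of_discrete.comp (hm 0)).aestronglyMeasurable)
    ((hψ.comp (measurable_pi_lambda _ fun t => hm (t + 1))).aestronglyMeasurable)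
  simp only [Function.comp_apply] at h2
  rw [h2]
  congr 1
  rw [← integral_indicator_one (measurableSet_fun_eq (hm 0) b)]
  refine integral_congr_ae (Filter.Eventually.of_forall fun ω => ?_)
  by_cases hb : x 0 ω = b <;> simp [hb]

/-- The coins after the first day, and those after the repair, are again independent with the same
bias, so the induction runs over all coin sequences. -/
lemma integral_faultCount (hm : ∀ t, Measurable (x t)) (hx : iIndepFun x μ)
    (hp : ∀ t, μ.real {ω | x t ω = true} = p) (N : ℕ) (φ : ℕ → ℝ) :
    ∫ ω, φ (faultCount d N fun t => x t ω) ∂μ = faultExpectation d p N φ := by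
  induction N using Nat.strong_induction_on generalizing x φ with
  | _ N ih =>
    cases N with
    | zero => simp [faultCount, faultExpectation_zero]
    | succ N =>
      have hpf : μ.real {ω | x 0 ω = false} = 1 - p := by
        rw [← hp 0, ← probReal_compl_eq_one_sub (measurableSet_fun_eq (hm 0) true)]
        congr 1
        ext ω
        simp
      have hsplit : ∀ ω, φ (faultCount d (N + 1) fun t => x t ω)
          = (if x 0 ω = false then 1 else 0) * φ (faultCount d N fun t => x (t + 1) ω)
            + (if x 0 ω = true then 1 else 0)
              * φ (faultCount d (N - d) (fun t => x (d + t + 1) ω) + 1) := by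
        intro ω
        cases h : x 0 ω with
        | false => rw [faultCount_succ_of_false h]; simp
        | true =>
          rw [faultCount_succ_of_true h]
          simp only [Nat.add_right_comm d 1]
          simp
      have hs : ∀ m, iIndepFun (fun t => x (m + t + 1)) μ := fun m =>
        hx.precomp (g := fun t => m + t + 1) fun a b h => by simpa using h
      have hψ0 : Measurable fun y : ℕ → Bool => φ (faultCount d N y) :=
        (Measurable.of_discrete (f := φ)).comp (measurable_faultCount N)
      have hψ1 : Measurable fun y : ℕ → Bool =>
          φ (faultCount d (N - d) (fun t => y (d + t)) + 1) :=
        (Measurable.of_discrete (f := fun k => φ (k + 1))).comp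
          ((measurable_faultCount (N - d)).comp
            (measurable_pi_lambda _ fun s => measurable_pi_apply _))
      have hint : ∀ (b : Bool) (M : ℕ) (y : ℕ → Ω → Bool) (ψ : ℕ → ℝ), (∀ t, Measurable (y t)) →
          Integrable (fun ω => (if x 0 ω = b then (1 : ℝ) else 0)
            * ψ (faultCount d M fun t => y t ω)) μ := by
        intro b M y ψ hy
        refine Integrable.bdd_mul (c := 1) ?_ ?_ ?_
        · exact integrable_comp_of_le ((measurable_faultCount M).comp
            (measurable_pi_lambda _ hy)) (fun ω => faultCount_le_days M _) ψ
        · exact ((Measurable.of_discrete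
            (f := fun c : Bool => if c = b then (1 : ℝ) else 0)).comp (hm 0)).aestronglyMeasurable
        · exact Filter.Eventually.of_forall fun ω => by split_ifs <;> simp
      simp only [hsplit]
      rw [integral_add (hint false N (fun t => x (t + 1)) φ fun t => hm _)
        (hint true (N - d) (fun t => x (d + t + 1)) (fun k => φ (k + 1)) fun t => hm _),
        integral_ite_zero_mul hm hx false hψ0, integral_ite_zero_mul hm hx true hψ1, hpf, hp 0,
        faultExpectation_succ]
      congr 2
      · have := hs 0
        simp only [Nat.zero_add] at this
        exact ih N (by omega) (fun t => hm _) this (fun t => hp _) φ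
      · exact ih (N - d) (by omega) (fun t => hm _) (hs d) (fun t => hp _) (fun k => φ (k + 1))

end Coins

/-! ### The approximation bound and its order in p -/

theorem proposition1 (N R down : ℕ) (hN : 1 ≤ N) (hR : 1 ≤ R)
    (hdown : down + 1 = R ∨ down = R) :
    ∃ C : ℝ, ∀ (p : ℝ), 0 < p → p ≤ 1 →
      ∀ (Ω : Type*) [MeasurableSpace Ω] (μ : Measure Ω) [IsProbabilityMeasure μ]
        (x : ℕ → Ω → Bool), (∀ t, Measurable (x t)) → iIndepFun x μ →
        (∀ t, μ.real {ω | x t ω = true} = p) →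
        ∀ (W : Ω → ℕ), (W = fun ω => faultCount down N (fun t => x t ω)) →
        ∀ (n : ℕ), n = N / R + 1 →
        ∀ (lam : ℝ), lam = ∫ ω, (W ω : ℝ) ∂μ →
          dTV (μ.map W) (truncPoisson n lam)
              ≤ steinBound n lam (variance (fun ω => (W ω : ℝ)) μ) ∧
          |steinBound n lam (variance (fun ω => (W ω : ℝ)) μ)| ≤ C * p := by
  -- The first factor bounds the Stein factor with B = N; the second comes from |λ - Var W| ≤ λ + nλ
  -- ≤ (N + nN)p.
  refine ⟨2 * ((N : ℝ) + 1) ^ (N / R + 1 + 1) * (N + (N / R + 1 : ℕ) * N), ?_⟩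
  intro p hp0 hp1 Ω _ μ _ x hm hx hp W hW n hn lam hlam
  have hE : ∀ φ : ℕ → ℝ, ∫ ω, φ (W ω) ∂μ = faultExpectation down p N φ := by
    intro φ
    rw [hW]
    exact integral_faultCount hm hx hp N φ
  have hWm : Measurable W := by
    rw [hW]
    exact (measurable_faultCount N).comp (measurable_pi_lambda _ hm)
  have hWn : ∀ ω, W ω ≤ n := by
    rw [hW, hn]
    exact fun ω => faultCount_le hR (by omega) N _
  have hlamE : lam = faultExpectation down p N (fun k => (k : ℝ)) := hlam.trans (hE _)
  have hpos : 0 < lam := hlamE ▸ hp0.trans_le (le_faultExpectation_cast hp0.le hp1 hN)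
  have hlamNp : lam ≤ N * p := hlamE ▸ faultExpectation_cast_le hp0.le hp1 N
  have hlamN : lam ≤ N := hlamNp.trans (mul_le_of_le_one_right N.cast_nonneg hp1)
  refine ⟨dTV_truncPoisson_le_steinBound hWm hWn hlam hpos fun k => ?_, ?_⟩
  · rw [hE fun j => (j : ℝ) * (if k < j then 1 else 0), hE fun j => if k ≤ j then 1 else 0, hlamE]
    exact faultExpectation_sizeBias_le hp0.le hp1 N k
  · have hv := variance_le_mul_integral (μ := μ) hWm hWn
    rw [← hlam] at hv
    have hv0 := variance_nonneg (fun ω => (W ω : ℝ)) μ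
    have hnv := mul_le_mul_of_nonneg_left hlamNp (Nat.cast_nonneg (α := ℝ) n)
    have hnN : 0 ≤ (n : ℝ) * (N * p) := by positivity
    rw [steinBound_eq hpos.ne', abs_mul, abs_of_nonneg steinFactor_nonneg, mul_assoc _ _ p, ← hn]
    refine mul_le_mul (steinFactor_le hpos hlamN) ?_ (abs_nonneg _) (by positivity)
    rw [abs_le]
    constructor <;> linarith
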